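/- Let $F_2$ be the free group on $x_1,x_2$, let $H=F_2^{\mathrm{ab}}$ be its abelianization, and let $\mathrm{Aut}\,F_2$ act on $F_2$ from the right, $x\mapsto x^{\sigma}$. Let $\mathrm{IA}_2$ be the kernel of the natural homomorphism $\mathrm{Aut}\,F_2\to\mathrm{Aut}\,H$. For $i=1,2$ let $\frac{\partial}{\partial x_i}:\mathbb Z[F_2]\to\mathbb Z[F_2]$ be the Fox derivation, i.e. the additive map with $$\frac{\partial w}{\partial x_i}=\sum_{j=1}^{r}\epsilon_j\,\delta_{\mu_j,i}\,x_{\mu_1}^{\epsilon_1}\cdots x_{\mu_{j-1}}^{\epsilon_{j-1}}x_{\mu_j}^{\frac12(\epsilon_j-1)}$$ for every reduced word $w=x_{\mu_1}^{\epsilon_1}\cdots x_{\mu_r}^{\epsilon_r}$, $\epsilon_j=\pm1$, and let $\mathfrak a:\mathbb Z[F_2]\to\mathbb Z[H]$ be the ring homomorphism induced by the abelianization. Let $\mathcal K_2$ be the kernel of the Magnus representation $$r_M:\mathrm{IA}_2\to \mathrm{GL}(2,\mathbb Z[H]),\qquad \sigma\mapsto\left(\Bigl(\frac{\partial (x_i^{\sigma})}{\partial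 x_j}\Bigr)^{\mathfrak a}\right)_{i,j}.$$ Then the map sending $g$ to the inner automorphism $x\mapsto g^{-1}xg$ is an isomorphism from the second derived subgroup $[[F_2,F_2],[F_2,F_2]]$ onto $\mathcal K_2$, and $\mathcal K_2$ is a free group of countably infinite rank. -/

import Mathlib

noncomputable section

/-- The automorphism group of `G` acting on `G` from the right: the product `σ * τ` is
"first `σ`, then `τ`". -/
abbrev RightAut (G : Type*) [Group G] : Type _ := (MulAut G)ᵐᵒᵖ

/-- The right action `x ^ σ` of an automorphism on an element. -/
def RightAut.act {G : Type*} [Group G] (σ : RightAut G) (x : G) : G := σ.unop x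

/-- The abelianization `H` of the free group `F_n` (written multiplicatively). -/
abbrev FreeAb (n : ℕ) : Type := Abelianization (FreeGroup (Fin n))

/-- The natural homomorphism `Aut G → Aut G^ab`. -/
def autAb (G : Type*) [Group G] : RightAut G →* RightAut (Abelianization G) where
  toFun σ := MulOpposite.op (MulEquiv.abelianizationCongr σ.unop)
  map_one' := by
    apply MulOpposite.unop_injective
    exact abelianizationCongr_refl
  map_mul' σ τ := by
    apply MulOpposite.unop_injective
    exact (abelianizationCongr_trans σ.unop τ.unop).symm

/-- The IA-automorphism group of `F_n`: the automorphisms acting trivially on `H`. -/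
def IAut (n : ℕ) : Subgroup (RightAut (FreeGroup (Fin n))) := (autAb (FreeGroup (Fin n))).ker

/-- For a word `w = x_{μ₁}^{ε₁} ⋯ x_{μᵣ}^{εᵣ}` (a letter `(μ, true)` stands for `x_μ` and
`(μ, false)` for `x_μ⁻¹`), the sum over all `j` with `μⱼ = i` of
`εⱼ x_{μ₁}^{ε₁} ⋯ x_{μⱼ₋₁}^{εⱼ₋₁} x_{μⱼ}^{(εⱼ - 1) / 2}`, computed by recursion on the word. -/
def foxList {n : ℕ} (i : Fin n) : List (Fin n × Bool) → MonoidAlgebra ℤ (FreeGroup (Fin n))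
  | [] => 0
  | (m, true) :: L =>
      (if m = i then 1 else 0) + MonoidAlgebra.of ℤ _ (FreeGroup.of m) * foxList i L
  | (m, false) :: L =>
      (if m = i then -MonoidAlgebra.of ℤ _ (FreeGroup.of m)⁻¹ else 0)
        + MonoidAlgebra.of ℤ _ (FreeGroup.of m)⁻¹ * foxList i L

/-- The Fox derivation `∂/∂x_i : ℤ[F_n] → ℤ[F_n]`: on `w ∈ F_n` it is the formula above for the
reduced word of `w`, and it is extended additively. -/
def foxDeriv {n : ℕ} (i : Fin n) (a : MonoidAlgebra ℤ (FreeGroup (Fin n))) :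
    MonoidAlgebra ℤ (FreeGroup (Fin n)) :=
  a.coeff.sum fun w c => c • foxList i w.toWord

/-- The ring homomorphism `ℤ[F_n] → ℤ[H]` induced by the abelianization. -/
def ringAb (n : ℕ) : MonoidAlgebra ℤ (FreeGroup (Fin n)) →+* MonoidAlgebra ℤ (FreeAb n) :=
  MonoidAlgebra.mapDomainRingHom ℤ (Abelianization.of : FreeGroup (Fin n) →* FreeAb n)

/-- The Magnus matrix of `σ`: its `(i, j)` entry is the image in `ℤ[H]` of `∂(x_i ^ σ)/∂x_j`. -/
def magnusMatrix {n : ℕ} (σ : RightAut (FreeGroup (Fin n))) :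
    Matrix (Fin n) (Fin n) (MonoidAlgebra ℤ (FreeAb n)) :=
  Matrix.of fun i j =>
    ringAb n (foxDeriv j (MonoidAlgebra.of ℤ _ (σ.act (FreeGroup.of i))))

theorem foxDeriv_of {n : ℕ} (i : Fin n) (w : FreeGroup (Fin n)) :
    foxDeriv i (MonoidAlgebra.of ℤ _ w) = foxList i w.toWord := by
  simp [foxDeriv, MonoidAlgebra.of_apply]

theorem foxList_append {n : ℕ} (i : Fin n) (L L' : List (Fin n × Bool)) :
    foxList i (L ++ L') =
      foxList i L + MonoidAlgebra.of ℤ _ (FreeGroup.mk L) * foxList i L' := by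
  induction L with
  | nil =>
    have h : (FreeGroup.mk [] : FreeGroup (Fin n)) = 1 := rfl
    rw [h, map_one]
    simp [foxList]
  | cons p L ih =>
    obtain ⟨m, b⟩ := p
    cases b with
    | true =>
      have h : (FreeGroup.mk ((m, true) :: L) : FreeGroup (Fin n)) =
        FreeGroup.of m * FreeGroup.mk L := rfl
      rw [h, map_mul, List.cons_append, foxList, foxList, ih]
      noncomm_ring
    | false =>
      have h : (FreeGroup.mk ((m, false) :: L) : FreeGroup (Fin n)) =
        (FreeGroup.of m)⁻¹ * FreeGroup.mk L := rfl
      rw [h, map_mul, List.cons_append, foxList, foxList, ih]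
      noncomm_ring

theorem foxList_step {n : ℕ} (i : Fin n) {L L' : List (Fin n × Bool)}
    (h : FreeGroup.Red.Step L L') : foxList i L = foxList i L' := by
  obtain @⟨L₁, L₂, m, b⟩ := h
  rw [foxList_append, foxList_append]
  congr 2
  have h1 : MonoidAlgebra.of ℤ (FreeGroup (Fin n)) (FreeGroup.of m) *
      MonoidAlgebra.of ℤ _ (FreeGroup.of m)⁻¹ = 1 := by
    rw [← map_mul, mul_inv_cancel, map_one]
  have h2 : MonoidAlgebra.of ℤ (FreeGroup (Fin n)) (FreeGroup.of m)⁻¹ *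
      MonoidAlgebra.of ℤ _ (FreeGroup.of m) = 1 := by
    rw [← map_mul, inv_mul_cancel, map_one]
  cases b with
  | true =>
    simp only [Bool.not_true, foxList, mul_add, ← mul_assoc, h1, one_mul]
    split_ifs <;> simp [h1, -MonoidAlgebra.of_apply]
  | false =>
    simp only [Bool.not_false, foxList, mul_add, ← mul_assoc, h2, one_mul]
    split_ifs <;> simp [-MonoidAlgebra.of_apply]

theorem foxList_red {n : ℕ} (i : Fin n) {L L' : List (Fin n × Bool)}
    (h : FreeGroup.Red L L') : foxList i L = foxList i L' := by
  induction h with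
  | refl => rfl
  | tail _ h ih => exact ih.trans (foxList_step i h)

theorem foxDeriv_mk {n : ℕ} (i : Fin n) (L : List (Fin n × Bool)) :
    foxDeriv i (MonoidAlgebra.of ℤ _ (FreeGroup.mk L)) = foxList i L := by
  rw [foxDeriv_of, FreeGroup.toWord_mk]
  exact (foxList_red i FreeGroup.reduce.red).symm

theorem foxDeriv_of_mul {n : ℕ} (i : Fin n) (v w : FreeGroup (Fin n)) :
    foxDeriv i (MonoidAlgebra.of ℤ _ (v * w)) =
      foxDeriv i (MonoidAlgebra.of ℤ _ v) +
        MonoidAlgebra.of ℤ _ v * foxDeriv i (MonoidAlgebra.of ℤ _ w) := by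
  have h : v * w = FreeGroup.mk (v.toWord ++ w.toWord) := by
    rw [← FreeGroup.mul_mk, FreeGroup.mk_toWord, FreeGroup.mk_toWord]
  rw [h, foxDeriv_mk, foxList_append, FreeGroup.mk_toWord, foxDeriv_of, foxDeriv_of]

theorem foxDeriv_one {n : ℕ} (i : Fin n) :
    foxDeriv i (MonoidAlgebra.of ℤ (FreeGroup (Fin n)) 1) = 0 := by
  rw [foxDeriv_of, FreeGroup.toWord_one, foxList]

theorem foxDeriv_gen {n : ℕ} (i m : Fin n) :
    foxDeriv i (MonoidAlgebra.of ℤ _ (FreeGroup.of m)) = if m = i then 1 else 0 := by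
  simp [foxDeriv_of, foxList, -MonoidAlgebra.of_apply]

theorem ringAb_of {n : ℕ} (w : FreeGroup (Fin n)) :
    ringAb n (MonoidAlgebra.of ℤ _ w) = MonoidAlgebra.of ℤ _ (Abelianization.of w) := by
  simp [ringAb]

theorem IAut.ab_act {n : ℕ} {τ : RightAut (FreeGroup (Fin n))} (hτ : τ ∈ IAut n)
    (w : FreeGroup (Fin n)) : Abelianization.of (τ.act w) = Abelianization.of w := by
  have h : MulEquiv.abelianizationCongr τ.unop = 1 := congrArg MulOpposite.unop hτ
  have h2 := DFunLike.congr_fun h (Abelianization.of w)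
  rwa [abelianizationCongr_of] at h2

/-- The chain rule for an automorphism acting trivially on `H`. -/
theorem foxDeriv_chain {n : ℕ} {τ : RightAut (FreeGroup (Fin n))} (hτ : τ ∈ IAut n)
    (j : Fin n) (w : FreeGroup (Fin n)) :
    ringAb n (foxDeriv j (MonoidAlgebra.of ℤ _ (τ.act w))) =
      ∑ k, ringAb n (foxDeriv k (MonoidAlgebra.of ℤ _ w)) * magnusMatrix τ k j := by
  have hmul : ∀ v w : FreeGroup (Fin n), τ.act (v * w) = τ.act v * τ.act w :=
    fun v w => map_mul τ.unop v w
  have hone : τ.act 1 = 1 := map_one τ.unop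
  have key : ∀ v w : FreeGroup (Fin n),
      (ringAb n (foxDeriv j (MonoidAlgebra.of ℤ _ (τ.act v))) =
        ∑ k, ringAb n (foxDeriv k (MonoidAlgebra.of ℤ _ v)) * magnusMatrix τ k j) →
      (ringAb n (foxDeriv j (MonoidAlgebra.of ℤ _ (τ.act w))) =
        ∑ k, ringAb n (foxDeriv k (MonoidAlgebra.of ℤ _ w)) * magnusMatrix τ k j) →
      ringAb n (foxDeriv j (MonoidAlgebra.of ℤ _ (τ.act (v * w)))) =
        ∑ k, ringAb n (foxDeriv k (MonoidAlgebra.of ℤ _ (v * w))) * magnusMatrix τ k j := by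
    intro v w hv hw
    rw [hmul, foxDeriv_of_mul, map_add, map_mul, hv, hw, ringAb_of, IAut.ab_act hτ]
    simp only [foxDeriv_of_mul]
    simp only [map_add, map_mul, add_mul, Finset.sum_add_distrib,
      Finset.mul_sum, ringAb_of, mul_assoc]
  induction w using FreeGroup.induction_on with
  | C1 => rw [hone]; simp only [foxDeriv_one, map_zero, zero_mul, Finset.sum_const_zero]
  | of m => simp [foxDeriv_gen, magnusMatrix, apply_ite, ite_mul, -MonoidAlgebra.of_apply]
  | inv_of m ih =>
    have hinv : ∀ (i : Fin n) (g : FreeGroup (Fin n)),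
        foxDeriv i (MonoidAlgebra.of ℤ _ g⁻¹) =
          -(MonoidAlgebra.of ℤ _ g⁻¹ * foxDeriv i (MonoidAlgebra.of ℤ _ g)) := by
      intro i g
      have h := foxDeriv_of_mul i g⁻¹ g
      rw [inv_mul_cancel, foxDeriv_one] at h
      exact eq_neg_of_add_eq_zero_left h.symm
    have h' : τ.act (FreeGroup.of m)⁻¹ = (τ.act (FreeGroup.of m))⁻¹ := map_inv τ.unop _
    change ringAb n (foxDeriv j (MonoidAlgebra.of ℤ _ (τ.act (FreeGroup.of m)))) = _ at ih
    change ringAb n (foxDeriv j (MonoidAlgebra.of ℤ _ (τ.act (FreeGroup.of m)⁻¹))) =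
      ∑ k, ringAb n (foxDeriv k (MonoidAlgebra.of ℤ _ (FreeGroup.of m)⁻¹)) * magnusMatrix τ k j
    rw [h', hinv, map_neg, map_mul, ih, ringAb_of, map_inv, IAut.ab_act hτ]
    simp only [hinv, map_neg, map_mul, ringAb_of, Finset.mul_sum, neg_mul,
      Finset.sum_neg_distrib, mul_assoc, map_inv]
  | mul v w hv hw => exact key v w hv hw

/-- The Magnus representation of `IA_n`, `σ ↦ (∂(x_i ^ σ)/∂x_j)^𝔞 ∈ GL(n, ℤ[H])`. -/
def magnusRep (n : ℕ) : IAut n →* GL (Fin n) (MonoidAlgebra ℤ (FreeAb n)) :=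
  MonoidHom.toHomUnits
    { toFun := fun σ => magnusMatrix (σ : RightAut (FreeGroup (Fin n)))
      map_one' := by
        ext1 i j
        change ringAb n (foxDeriv j (MonoidAlgebra.of ℤ _ (FreeGroup.of i))) = _
        rw [foxDeriv_gen, apply_ite (ringAb n), map_one, map_zero, Matrix.one_apply]
      map_mul' := by
        intro σ τ
        ext1 i j
        rw [Matrix.mul_apply]
        exact foxDeriv_chain τ.2 j _ }

theorem magnusRep_val {n : ℕ} (σ : IAut n) :
    ((magnusRep n σ : GL (Fin n) (MonoidAlgebra ℤ (FreeAb n))) :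
      Matrix (Fin n) (Fin n) (MonoidAlgebra ℤ (FreeAb n))) = magnusMatrix σ.1 := rfl

/-- The kernel `K_n` of the Magnus representation of `IA_n`. -/
def magnusKernel (n : ℕ) : Subgroup (IAut n) := (magnusRep n).ker

/-- The second derived subgroup `[[G, G], [G, G]]`. -/
def secondDerived (G : Type*) [Group G] : Subgroup G := ⁅commutator G, commutator G⁆

end

/-! Write F for F_2. Three classical facts combine.

Nielsen: every element of IA_2 is inner. Cancellation arguments show that any generating pair of F
arises, up to inverting entries, from a pair of letters by conjugation, exchange and multiplication
of one entry by the other (`FreeGroup.signedPositivePair_of_closure_eq_top`). A suitably signed sum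
of the two exponent sums is positive on both entries, and each multiplication raises its total
(`FreeGroup.PositivePair.exists_weights`). A pair congruent to the standard basis modulo commutators
has total 2, so no multiplication occurs and the pair is conjugate to the basis.

Magnus: for the inner automorphism given by g, the identity g ∂_j(g⁻¹ x_i g) = ∂_j x_i + (x_i - 1)
∂_j g, read in ℤ[H], shows that the Magnus matrix is trivial iff g ∈ [F, F] and every ∂_j g
vanishes. By `mem_commutator_of_foxAlong_eq_zero` and its converse, this says that g lies in the
second derived subgroup. Read in ℤ[F], the same identity shows that only g = 1 acts trivially.

Infinite rank: the second derived subgroup is free by Nielsen–Schreier. On a normal subgroup N the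
Fox derivatives in ℤ[F/N] are additive, so finite generation would confine their supports to a
finite set; conjugation, however, translates them all over F/N (`not_finitelyGenerated_ker`). -/

noncomputable section

/-! ### Fox calculus over a quotient, and Magnus's theorem -/

/-- The Fox derivative of `w` with coefficients pushed forward along `π`. -/
def foxAlong {n : ℕ} {Q : Type*} [Group Q] (π : FreeGroup (Fin n) →* Q) (j : Fin n)
    (w : FreeGroup (Fin n)) : MonoidAlgebra ℤ Q :=
  MonoidAlgebra.mapDomainRingHom ℤ π (foxDeriv j (MonoidAlgebra.of ℤ _ w))

section Along

variable {n : ℕ} {Q : Type*} [Group Q] (π : FreeGroup (Fin n) →* Q)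

theorem foxAlong_mul (j : Fin n) (v w : FreeGroup (Fin n)) :
    foxAlong π j (v * w) = foxAlong π j v + MonoidAlgebra.of ℤ Q (π v) * foxAlong π j w := by
  have h : MonoidAlgebra.mapDomainRingHom ℤ π (MonoidAlgebra.of ℤ _ v) =
      MonoidAlgebra.of ℤ Q (π v) := by simp
  rw [foxAlong, foxDeriv_of_mul, map_add, map_mul, h]
  rfl

theorem foxAlong_one (j : Fin n) : foxAlong π j 1 = 0 := by
  simp only [foxAlong, foxDeriv_one, map_zero]

theorem foxAlong_gen (j m : Fin n) :
    foxAlong π j (FreeGroup.of m) = if m = j then 1 else 0 := by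
  rw [foxAlong, foxDeriv_gen, apply_ite (MonoidAlgebra.mapDomainRingHom ℤ π), map_one, map_zero]

theorem foxAlong_inv (j : Fin n) (w : FreeGroup (Fin n)) :
    foxAlong π j w⁻¹ = -(MonoidAlgebra.of ℤ Q (π w⁻¹) * foxAlong π j w) := by
  have h := foxAlong_mul π j w⁻¹ w
  rw [inv_mul_cancel, foxAlong_one] at h
  exact eq_neg_of_add_eq_zero_left h.symm

/-- This makes the derivative equivariant on the kernel: conjugation becomes translation in the
group ring. -/
theorem foxAlong_conj (j : Fin n) (h r : FreeGroup (Fin n)) (hr : r ∈ π.ker) :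
    foxAlong π j (h * r * h⁻¹) = MonoidAlgebra.of ℤ Q (π h) * foxAlong π j r := by
  rw [foxAlong_mul, foxAlong_mul, foxAlong_inv, map_mul, hr, mul_one, map_inv, mul_neg,
    ← mul_assoc, ← map_mul, mul_inv_cancel, map_one, one_mul]
  abel

variable (s : Q → FreeGroup (Fin n)) (hs : ∀ q, π (s q) = q)

/-- The element `s(q) w s(q π(w))⁻¹` of the kernel attached to a section `s`. -/
def sectionCocycle (q : Q) (w : FreeGroup (Fin n)) : π.ker :=
  ⟨s q * w * (s (q * π w))⁻¹, by simp [MonoidHom.mem_ker, hs]⟩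

/-- The class of `s(q) w s(q π(w))⁻¹` in the abelianized kernel, written additively. -/
def sectionClass (q : Q) (w : FreeGroup (Fin n)) : Additive (Abelianization π.ker) :=
  Additive.ofMul (Abelianization.of (sectionCocycle π s hs q w))

theorem sectionClass_mul (q : Q) (v w : FreeGroup (Fin n)) :
    sectionClass π s hs q (v * w) =
      sectionClass π s hs q v + sectionClass π s hs (q * π v) w := by
  rw [sectionClass, sectionClass, sectionClass, ← ofMul_mul, ← map_mul]
  congr 2
  apply Subtype.ext
  simp [sectionCocycle, mul_assoc]

/-- The additive map `ℤ[Q] → N/[N,N]` sending `q` to the class of `s(q) x_j s(q π(x_j))⁻¹`. -/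
def sectionHom (j : Fin n) : MonoidAlgebra ℤ Q →+ Additive (Abelianization π.ker) where
  toFun a := a.coeff.sum fun q c => c • sectionClass π s hs q (FreeGroup.of j)
  map_zero' := by simp
  map_add' a b := by
    rw [MonoidAlgebra.coeff_add]
    exact Finsupp.sum_add_index' (fun _ => zero_smul _ _) (fun _ _ _ => add_smul _ _ _)

theorem sectionHom_of (j : Fin n) (q : Q) :
    sectionHom π s hs j (MonoidAlgebra.of ℤ Q q) = sectionClass π s hs q (FreeGroup.of j) := by
  change (MonoidAlgebra.of ℤ Q q).coeff.sum
    (fun q c => c • sectionClass π s hs q (FreeGroup.of j)) = _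
  simp [MonoidAlgebra.of_apply]

/-- Both sides obey the same product rule in `w` (for the right side, `sectionClass_mul`) and agree
on generators. Hence the class of an element in the abelianized kernel is determined by its Fox
derivatives. The statement ranges over all `q` because the product rule shifts `q`. -/
theorem sum_sectionHom_foxAlong (w : FreeGroup (Fin n)) : ∀ q : Q,
    ∑ j, sectionHom π s hs j (MonoidAlgebra.of ℤ Q q * foxAlong π j w) =
      sectionClass π s hs q w := by
  have hone : ∀ q : Q, sectionClass π s hs q 1 = 0 := by
    intro q
    have h := sectionClass_mul π s hs q 1 1
    simpa using h
  induction w using FreeGroup.induction_on with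
  | C1 =>
    intro q
    simp only [foxAlong_one, mul_zero, map_zero, Finset.sum_const_zero, hone]
  | of m =>
    intro q
    simp only [foxAlong_gen, mul_ite, mul_one, mul_zero]
    rw [Finset.sum_eq_single m]
    · rw [if_pos rfl, sectionHom_of]
    · intro j _ hj
      rw [if_neg (Ne.symm hj), map_zero]
    · simp
  | inv_of m ih =>
    intro q
    have h := sectionClass_mul π s hs q (FreeGroup.of m)⁻¹ (FreeGroup.of m)
    rw [inv_mul_cancel, hone] at h
    have h2 := ih (q * π (FreeGroup.of m)⁻¹)
    change ∑ j, sectionHom π s hs j (MonoidAlgebra.of ℤ Q (q * π (FreeGroup.of m)⁻¹) *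
      foxAlong π j (FreeGroup.of m)) = sectionClass π s hs _ (FreeGroup.of m) at h2
    change ∑ j, sectionHom π s hs j (MonoidAlgebra.of ℤ Q q * foxAlong π j (FreeGroup.of m)⁻¹) =
      sectionClass π s hs q (FreeGroup.of m)⁻¹
    rw [eq_neg_of_add_eq_zero_left h.symm, ← h2]
    simp only [foxAlong_inv, map_mul, mul_neg, map_neg, Finset.sum_neg_distrib, mul_assoc]
  | mul v w hv hw =>
    intro q
    rw [sectionClass_mul, ← hv q, ← hw (q * π v), ← Finset.sum_add_distrib]
    simp only [foxAlong_mul, mul_add, map_add, map_mul, mul_assoc]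

/-- Magnus: an element of `N` with vanishing Fox derivatives in `ℤ[F/N]` lies in `[N, N]`. -/
theorem mem_commutator_of_foxAlong_eq_zero (hπ : Function.Surjective π)
    {r : FreeGroup (Fin n)} (hr : r ∈ π.ker) (h : ∀ j, foxAlong π j r = 0) :
    r ∈ ⁅π.ker, π.ker⁆ := by
  obtain ⟨s, hs⟩ := hπ.hasRightInverse
  have h1 := sum_sectionHom_foxAlong π s hs r 1
  simp only [h, mul_zero, map_zero, Finset.sum_const_zero] at h1
  have h2 : Abelianization.of (sectionCocycle π s hs 1 r) = 1 := (ofMul_eq_zero.mp h1.symm)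
  have h3 : sectionCocycle π s hs 1 r ∈ commutator π.ker := by
    rw [← Abelianization.ker_of]; exact h2
  -- The section need not send 1 to 1, but `s 1` lies in the kernel, so this conjugation preserves
  -- its commutator subgroup.
  have h4 : sectionCocycle π s hs 1 r =
      ⟨s 1, hs 1⟩ * (⟨r, hr⟩ : π.ker) * (⟨s 1, hs 1⟩ : π.ker)⁻¹ := by
    apply Subtype.ext
    simp [sectionCocycle, MonoidHom.mem_ker.mp hr]
  have h5 : (⟨r, hr⟩ : π.ker) ∈ commutator π.ker := by
    have := (inferInstance : (commutator π.ker).Normal).conj_mem' _ h3 ⟨s 1, hs 1⟩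
    rw [h4] at this
    simpa [mul_assoc] using this
  have h6 : r ∈ (commutator π.ker).map π.ker.subtype := ⟨_, h5, rfl⟩
  rwa [commutator_def, Subgroup.map_commutator, ← MonoidHom.range_eq_map,
    Subgroup.range_subtype] at h6

end Along

/-! ### Normal subgroups that are not finitely generated -/

/-- No finite set contains the supports of all translates of a nonzero element of the group ring
of an infinite group. -/
theorem exists_notMem_support_translate {Q : Type*} [Group Q] [Infinite Q]
    {a : MonoidAlgebra ℤ Q} (ha : a ≠ 0) (T : Finset Q) :
    ∃ q : Q, ¬ (MonoidAlgebra.of ℤ Q q * a).coeff.support ⊆ T := by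
  obtain ⟨p, hp⟩ : ∃ p, a.coeff p ≠ 0 := by
    by_contra! h
    exact ha (MonoidAlgebra.ext (Finsupp.ext h))
  obtain ⟨t, ht⟩ := Infinite.exists_notMem_finset T
  refine ⟨t * p⁻¹, fun h => ht (h ?_)⟩
  rw [Finsupp.mem_support_iff, MonoidAlgebra.of_apply]
  have := MonoidAlgebra.coeff_single_mul_apply a 1 (t * p⁻¹) t
  rw [this]
  simpa using hp

/-- An invariant element has constant coefficients along the orbits of `g`, which are infinite,
while its support is finite. -/
theorem eq_zero_of_translate_eq {Q : Type*} [Group Q] {g : Q} (hg : ¬ IsOfFinOrder g)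
    {a : MonoidAlgebra ℤ Q} (ha : MonoidAlgebra.of ℤ Q g * a = a) : a = 0 := by
  by_contra h0
  obtain ⟨p, hp⟩ : ∃ p, a.coeff p ≠ 0 := by
    by_contra! h
    exact h0 (MonoidAlgebra.ext (Finsupp.ext h))
  have hpow : ∀ k : ℕ, a.coeff (g ^ k * p) = a.coeff p := by
    intro k
    induction k with
    | zero => simp
    | succ k ih =>
      rw [← ih]
      conv_lhs => rw [← ha]
      rw [MonoidAlgebra.of_apply, MonoidAlgebra.coeff_single_mul_apply]
      simp [pow_succ', mul_assoc]
  have hinj : Function.Injective fun k : ℕ => g ^ k * p := by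
    intro k l hkl
    exact (injective_pow_iff_not_isOfFinOrder.mpr hg) (mul_right_cancel hkl)
  refine (Set.infinite_range_of_injective hinj) (a.coeff.support.finite_toSet.subset ?_)
  rintro _ ⟨k, rfl⟩
  simpa [hpow] using hp

/-- A nontrivial free group is not perfect. -/
theorem IsFreeGroup.commutator_ne_top (G : Type*) [Group G] [IsFreeGroup G] [Nontrivial G] :
    commutator G ≠ ⊤ := by
  intro h
  have hempty : IsEmpty (IsFreeGroup.Generators G) := by
    refine ⟨fun x => ?_⟩
    let f : G →* Multiplicative ℤ := IsFreeGroup.lift fun _ => Multiplicative.ofAdd 1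
    have h1 : f (IsFreeGroup.of x) = 1 :=
      Abelianization.commutator_subset_ker f (h ▸ Subgroup.mem_top _)
    rw [IsFreeGroup.lift_of] at h1
    exact absurd (ofAdd_eq_one.mp h1) one_ne_zero
  have : Subsingleton G := (IsFreeGroup.toFreeGroup G).injective.subsingleton
  exact not_subsingleton G this

/-- A nontrivial normal subgroup of infinite index in a free group of finite rank is not finitely
generated. -/
theorem not_finitelyGenerated_ker {n : ℕ} {Q : Type*} [Group Q] [Infinite Q]
    (π : FreeGroup (Fin n) →* Q) (hπ : Function.Surjective π) (hker : π.ker ≠ ⊥) :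
    ¬ Group.FG π.ker := by
  classical
  intro hfg
  have hnt : Nontrivial π.ker := (Subgroup.nontrivial_iff_ne_bot _).mpr hker
  -- Otherwise Magnus's theorem would make the kernel perfect, which a nontrivial free group is not.
  obtain ⟨r, hr, j, hj⟩ : ∃ r ∈ π.ker, ∃ j, foxAlong π j r ≠ 0 := by
    by_contra! h
    refine IsFreeGroup.commutator_ne_top π.ker (eq_top_iff.mpr fun r _ => ?_)
    have h1 := mem_commutator_of_foxAlong_eq_zero π hπ r.2 (h r r.2)
    have h2 : (commutator π.ker).map π.ker.subtype = ⁅π.ker, π.ker⁆ := by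
      rw [commutator_def, Subgroup.map_commutator, ← MonoidHom.range_eq_map,
        Subgroup.range_subtype]
    rw [← h2] at h1
    obtain ⟨r', hr', h3⟩ := h1
    rwa [← Subtype.ext (a1 := r') (a2 := r) h3]
  obtain ⟨S, hS⟩ := (Group.fg_def.mp hfg)
  -- Additivity on the kernel keeps the support of every derivative inside the union over the
  -- generators.
  let T : Finset Q := S.biUnion fun x => (foxAlong π j x).coeff.support
  have hsupp : ∀ x : π.ker, (foxAlong π j (x : FreeGroup (Fin n))).coeff.support ⊆ T := by
    intro x
    have hx : x ∈ Subgroup.closure (S : Set π.ker) := hS ▸ Subgroup.mem_top x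
    induction hx using Subgroup.closure_induction with
    | mem x hx => exact Finset.subset_biUnion_of_mem (fun x : π.ker =>
        (foxAlong π j (x : FreeGroup (Fin n))).coeff.support) hx
    | one => simp [foxAlong_one]
    | mul x y _ _ hx hy =>
      rw [Subgroup.coe_mul, foxAlong_mul, MonoidHom.mem_ker.mp x.2, map_one, one_mul]
      exact Finsupp.support_add.trans (Finset.union_subset hx hy)
    | inv x _ hx =>
      rw [Subgroup.coe_inv, foxAlong_inv, map_inv, MonoidHom.mem_ker.mp x.2, inv_one, map_one,
        one_mul, MonoidAlgebra.coeff_neg, Finsupp.support_neg]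
      exact hx
  obtain ⟨q, hq⟩ := exists_notMem_support_translate hj T
  obtain ⟨h, rfl⟩ := hπ q
  rw [← foxAlong_conj π j h r hr] at hq
  exact hq (hsupp ⟨_, π.normal_ker.conj_mem r hr h⟩)

end

/-! ### Cancellation in free groups and Nielsen reduced sets -/

noncomputable section

namespace FreeGroup

variable {α : Type*} [DecidableEq α]

/-- The length of the longest common prefix of two lists. -/
def commonPrefixLength {β : Type*} [DecidableEq β] : List β → List β → ℕ
  | a :: l, b :: m => if a = b then commonPrefixLength l m + 1 else 0
  | _, _ => 0

section CommonPrefix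

variable {β : Type*} [DecidableEq β]

theorem commonPrefixLength_comm : ∀ l m : List β,
    commonPrefixLength l m = commonPrefixLength m l
  | [], [] => rfl
  | [], _ :: _ => rfl
  | _ :: _, [] => rfl
  | a :: l, b :: m => by
    simp only [commonPrefixLength, commonPrefixLength_comm l m, eq_comm (a := a)]

/-- The ultrametric inequality for common prefixes, that is, the tree property of the Cayley graph.
-/
theorem min_commonPrefixLength_le : ∀ l m k : List β,
    min (commonPrefixLength l m) (commonPrefixLength m k) ≤ commonPrefixLength l k
  | [], _, _ => by simp [commonPrefixLength]
  | _ :: _, [], _ => by simp [commonPrefixLength]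
  | _ :: _, _ :: _, [] => by simp [commonPrefixLength]
  | a :: l, b :: m, c :: k => by
    have h := min_commonPrefixLength_le l m k
    simp only [commonPrefixLength]
    split_ifs <;> first | omega | simp_all

theorem take_eq_of_le_commonPrefixLength : ∀ (l m : List β) (k : ℕ),
    k ≤ commonPrefixLength l m → l.take k = m.take k
  | _, _, 0, _ => by simp
  | [], _, k + 1, h => by simp [commonPrefixLength] at h
  | _ :: _, [], k + 1, h => by simp [commonPrefixLength] at h
  | a :: l, b :: m, k + 1, h => by
    simp only [commonPrefixLength] at h
    split_ifs at h with hab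
    · rw [List.take_succ_cons, List.take_succ_cons, hab,
        take_eq_of_le_commonPrefixLength l m k (by omega)]
    · omega

end CommonPrefix

theorem isReduced_invRev {L : List (α × Bool)} (h : IsReduced L) : IsReduced (invRev L) := by
  rw [isReduced_iff_reduce_eq] at h ⊢
  rw [reduce_invRev, h]

theorem norm_inv_mk_mul_mk : ∀ {X Y : List (α × Bool)}, IsReduced X → IsReduced Y →
    norm ((mk X)⁻¹ * mk Y) + 2 * commonPrefixLength X Y = X.length + Y.length
  | [], Y, _, hY => by
    have : (mk ([] : List (α × Bool)))⁻¹ * mk Y = mk Y := by rw [← one_eq_mk]; simp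
    rw [this, norm, toWord_mk, hY.reduce_eq]
    simp [commonPrefixLength]
  | a :: X, [], hX, _ => by
    have : (mk (a :: X))⁻¹ * mk ([] : List (α × Bool)) = (mk (a :: X))⁻¹ := by
      rw [← one_eq_mk]; simp
    rw [this, norm_inv_eq, norm, toWord_mk, hX.reduce_eq]
    simp [commonPrefixLength]
  | a :: X, b :: Y, hX, hY => by
    by_cases hab : a = b
    · subst hab
      have h1 : ∀ Z : List (α × Bool), mk (a :: Z) = mk [a] * mk Z := fun Z => rfl
      have h2 : (mk (a :: X))⁻¹ * mk (a :: Y) = (mk X)⁻¹ * mk Y := by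
        rw [h1 X, h1 Y]; group
      have h3 := norm_inv_mk_mul_mk (X := X) (Y := Y) (hX.infix ⟨[a], [], by simp⟩)
        (hY.infix ⟨[a], [], by simp⟩)
      rw [h2]
      simp only [commonPrefixLength, if_true, List.length_cons]
      omega
    · have hred : IsReduced (invRev (a :: X) ++ b :: Y) := by
        refine List.isChain_append.mpr ⟨isReduced_invRev hX, hY, ?_⟩
        intro x hx y hy
        have hx' : x = (a.1, !a.2) := by
          rw [invRev_cons] at hx
          simpa [invRev, eq_comm] using hx
        have hy' : y = b := by simpa [eq_comm] using hy
        subst hx' hy'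
        intro h1
        have : a.2 ≠ y.2 := fun h2 => hab (Prod.ext h1 h2)
        cases h2 : a.2 <;> cases h3 : y.2 <;> simp_all
      rw [inv_mk, mul_mk, norm, toWord_mk, hred.reduce_eq]
      simp [commonPrefixLength, hab, invRev_length]

/-- The length of the longest common prefix of the reduced words of `x` and `y`. -/
def gromovProduct (x y : FreeGroup α) : ℕ := commonPrefixLength x.toWord y.toWord

theorem gromovProduct_comm (x y : FreeGroup α) : gromovProduct x y = gromovProduct y x :=
  commonPrefixLength_comm _ _

theorem min_gromovProduct_le (x y z : FreeGroup α) :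
    min (gromovProduct x y) (gromovProduct y z) ≤ gromovProduct x z :=
  min_commonPrefixLength_le _ _ _

theorem norm_inv_mul (x y : FreeGroup α) :
    norm (x⁻¹ * y) + 2 * gromovProduct x y = norm x + norm y := by
  have h := norm_inv_mk_mul_mk (isReduced_toWord (x := x)) (isReduced_toWord (x := y))
  rwa [mk_toWord, mk_toWord] at h

/-- Thus `gromovProduct x⁻¹ y` counts the letters of `x` cancelled in `x * y`. -/
theorem norm_mul (x y : FreeGroup α) :
    norm (x * y) + 2 * gromovProduct x⁻¹ y = norm x + norm y := by
  simpa using norm_inv_mul x⁻¹ y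

/-- If half of `x` cancelled against itself, the middle of its reduced word would contain adjacent
inverse letters (even length) or a letter equal to its own inverse (odd length). -/
theorem two_mul_gromovProduct_inv_self_lt {x : FreeGroup α} (hx : x ≠ 1) :
    2 * gromovProduct x⁻¹ x < norm x := by
  by_contra! h
  have hn : 0 < norm x := by
    rw [Nat.pos_iff_ne_zero]; exact fun h => hx (norm_eq_zero.mp h)
  set X := x.toWord with hX
  have hlen : X.length = norm x := rfl
  have htake := take_eq_of_le_commonPrefixLength _ _ _ (le_refl (gromovProduct x⁻¹ x))
  rw [toWord_inv, ← hX] at htake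
  set n := norm x
  have hi : (n - 1) / 2 < gromovProduct x⁻¹ x := by omega
  have hget := congrArg (fun l => l[(n - 1) / 2]?) htake
  simp only [List.getElem?_take, hi, if_true] at hget
  rw [invRev, List.getElem?_reverse (by simp; omega), List.getElem?_map, List.length_map,
    List.getElem?_eq_getElem (by omega), List.getElem?_eq_getElem (by omega)] at hget
  simp only [Option.map_some, Option.some.injEq] at hget
  have hget' : ∀ i j (hi : i < X.length) (hj : j < X.length), i = X.length - 1 - (n - 1) / 2 →
      j = (n - 1) / 2 → (X[i].1, !X[i].2) = X[j] := by
    rintro i j hi hj rfl rfl; exact hget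
  have hred : IsReduced X := isReduced_toWord
  rcases Nat.even_or_odd' n with ⟨m, hm | hm⟩
  · have h3 := List.isChain_iff_getElem.mp hred (m - 1) (by omega)
    have h4 := hget' (m - 1 + 1) (m - 1) (by omega) (by omega) (by omega) (by omega)
    rw [← h4] at h3
    simpa using h3 rfl
  · have h4 := hget' m m (by omega) (by omega) (by omega) (by omega)
    simpa using congrArg Prod.snd h4

/-- If the two halves of `y` are cancelled by `x` on either side, then `y` and `y * x` have a
simultaneous conjugate that is shorter. -/
theorem exists_conj_norm_le {x y : FreeGroup α} {m : ℕ} (hy : norm y = 2 * m)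
    (h1 : m ≤ gromovProduct x⁻¹ y) (h2 : m ≤ gromovProduct y⁻¹ x) (hx : 2 * m ≤ norm x) :
    ∃ p : FreeGroup α, norm (p⁻¹ * y * p) ≤ norm y ∧
      norm (p⁻¹ * (y * x) * p) + 2 * m ≤ norm x := by
  have split : ∀ (k : ℕ) (L : List (α × Bool)), mk (L.take k) * mk (L.drop k) = mk L := by
    intro k L; rw [mul_mk, List.take_append_drop]
  set X := x.toWord with hX
  set Y := y.toWord with hY
  have hlX : X.length = norm x := rfl
  have hlY : Y.length = norm y := rfl
  have e1 := take_eq_of_le_commonPrefixLength _ _ _ h1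
  have e2 := take_eq_of_le_commonPrefixLength _ _ _ h2
  rw [toWord_inv, ← hX, ← hY] at e1
  rw [toWord_inv, ← hX, ← hY] at e2
  have inv_take : ∀ (L : List (α × Bool)), (invRev L).take m = invRev (L.drop (L.length - m)) := by
    intro L
    rw [invRev, List.take_reverse, List.length_map, invRev, List.map_drop]
  rw [inv_take, hlX] at e1
  rw [inv_take, hlY, hy, show 2 * m - m = m by omega] at e2
  -- With `y = p q` cut into halves, the cancellations give `x = q⁻¹ z p⁻¹`. Conjugating by `p`
  -- turns `y` into `q p` and `y * x` into `z`.
  have hpy : (mk (Y.take m))⁻¹ * y = mk (Y.drop m) := by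
    rw [inv_mul_eq_iff_eq_mul, split, hY, mk_toWord]
  have hxp : x * mk (Y.take m) = mk (X.take (norm x - m)) := by
    rw [← e1, ← inv_mk, mul_inv_eq_iff_eq_mul, split, hX, mk_toWord]
  refine ⟨mk (Y.take m), ?_, ?_⟩
  · rw [hpy]
    refine (norm_mul_le _ _).trans ((add_le_add norm_mk_le norm_mk_le).trans ?_)
    rw [List.length_take, List.length_drop]
    omega
  · have h3 : (mk (Y.take m))⁻¹ * (y * x) * mk (Y.take m) =
        mk ((X.take (norm x - m)).drop m) := by
      calc _ = ((mk (Y.take m))⁻¹ * y) * (x * mk (Y.take m)) := by group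
        _ = (mk (X.take m))⁻¹ * mk (X.take (norm x - m)) := by
          rw [hpy, hxp, ← e2, inv_mk, invRev_invRev]
        _ = _ := by
          rw [inv_mul_eq_iff_eq_mul, ← split m (X.take (norm x - m)), List.take_take,
            min_eq_left (by omega)]
    rw [h3]
    have := norm_mk_le (L₁ := (X.take (norm x - m)).drop m)
    rw [List.length_drop, List.length_take] at this
    omega

/-- Nielsen's condition on a set of elements of a free group. -/
structure IsNielsenReduced (T : Set (FreeGroup α)) : Prop where
  ne_one : ∀ x ∈ T, x ≠ 1
  two_mul_le : ∀ x ∈ T, ∀ y ∈ T, x * y ≠ 1 →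
    2 * gromovProduct x⁻¹ y ≤ norm x ∧ 2 * gromovProduct x⁻¹ y ≤ norm y
  add_lt : ∀ x ∈ T, ∀ y ∈ T, ∀ z ∈ T, x * y ≠ 1 → y * z ≠ 1 →
    gromovProduct x⁻¹ y + gromovProduct y⁻¹ z < norm y

/-- The cancellation between `s` and the first element of `l`. -/
def headCancel (s : FreeGroup α) : List (FreeGroup α) → ℕ
  | [] => 0
  | t :: _ => gromovProduct s⁻¹ t

/-- The product keeps all of `s` except what cancels against the next factor. In the induction,
`add_lt` leaves a letter of `t` untouched from both sides, so `s` cancels against the whole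
remaining product exactly as it does against `t`. Since that is at most half of `s`, lengths do not
drop below 2. -/
theorem IsNielsenReduced.norm_prod {T : Set (FreeGroup α)} (hT : IsNielsenReduced T) :
    ∀ (l : List (FreeGroup α)) (s : FreeGroup α), (∀ t ∈ s :: l, t ∈ T) →
      (s :: l).IsChain (fun x y => x * y ≠ 1) →
      norm s ≤ gromovProduct s (s :: l).prod + headCancel s l ∧
        (l ≠ [] → 2 ≤ norm (s :: l).prod)
  | [], s, _, _ => by
    have h := norm_inv_mul s s
    rw [inv_mul_cancel, norm_one] at h
    simp [headCancel]
    omega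
  | t :: l, s, hmem, hc => by
    have hs : s ∈ T := hmem s (by simp)
    have ht : t ∈ T := hmem t (by simp)
    obtain ⟨hst, hc'⟩ := List.isChain_cons_cons.mp hc
    obtain ⟨ih1, ih2⟩ := hT.norm_prod l t (fun x hx => hmem x (List.mem_cons_of_mem _ hx)) hc'
    obtain ⟨b1, b2⟩ := hT.two_mul_le s hs t ht hst
    have pos : ∀ x ∈ T, 0 < norm x := fun x hx => by
      rw [Nat.pos_iff_ne_zero]; exact fun h => hT.ne_one x hx (norm_eq_zero.mp h)
    have hlt : gromovProduct s⁻¹ t + headCancel t l < norm t := by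
      cases l with
      | nil => have := pos t ht; simp only [headCancel]; omega
      | cons r l =>
        exact hT.add_lt s hs t ht r (hmem r (by simp)) hst (List.isChain_cons_cons.mp hc').1
    have hprod : (s :: t :: l).prod = s * (t :: l).prod := List.prod_cons
    set w := (t :: l).prod with hw
    have c1 := min_gromovProduct_le s⁻¹ t w
    have c2 := min_gromovProduct_le s⁻¹ w t
    rw [gromovProduct_comm w t] at c2
    have d1 := norm_mul s w
    have d2 := norm_inv_mul s (s * w)
    rw [inv_mul_cancel_left] at d2
    rw [hprod]
    refine ⟨by simp only [headCancel]; omega, fun _ => ?_⟩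
    cases l with
    | nil =>
      have hwt : w = t := by simp [hw]
      have := pos s hs
      have := pos t ht
      rw [hwt] at d1 ⊢
      omega
    | cons r l =>
      have := ih2 (by simp)
      omega

theorem exists_isChain_prod_eq {G : Type*} [Group G] {T : Set G} (hinv : ∀ x ∈ T, x⁻¹ ∈ T)
    (hgen : Subgroup.closure T = ⊤) (g : G) :
    ∃ l : List G, (∀ t ∈ l, t ∈ T) ∧ l.IsChain (fun x y => x * y ≠ 1) ∧ l.prod = g := by
  have hcons : ∀ x ∈ T, ∀ l : List G, (∀ t ∈ l, t ∈ T) → l.IsChain (fun x y => x * y ≠ 1) →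
      ∃ l' : List G, (∀ t ∈ l', t ∈ T) ∧ l'.IsChain (fun x y => x * y ≠ 1) ∧
        l'.prod = x * l.prod := by
    intro x hx l hl hc
    cases l with
    | nil => exact ⟨[x], by simpa using hx, List.isChain_singleton x, by simp⟩
    | cons y l =>
      by_cases hxy : x * y = 1
      · refine ⟨l, fun t ht => hl t (List.mem_cons_of_mem _ ht), hc.tail, ?_⟩
        rw [List.prod_cons, ← mul_assoc, hxy, one_mul]
      · refine ⟨x :: y :: l, ?_, List.isChain_cons_cons.mpr ⟨hxy, hc⟩, by simp⟩
        intro t ht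
        rcases List.mem_cons.mp ht with rfl | ht
        · exact hx
        · exact hl t ht
  have hg : g ∈ Subgroup.closure T := hgen ▸ Subgroup.mem_top g
  induction hg using Subgroup.closure_induction_left with
  | one => exact ⟨[], by simp, List.isChain_nil, rfl⟩
  | mul_left x hx y _ ih =>
    obtain ⟨l, hl, hc, rfl⟩ := ih
    exact hcons x hx l hl hc
  | inv_mul_cancel x hx y _ ih =>
    obtain ⟨l, hl, hc, rfl⟩ := ih
    exact hcons x⁻¹ (hinv x hx) l hl hc

/-- A Nielsen reduced generating set contains all elements of length one. -/
theorem IsNielsenReduced.mem_of_norm_eq_one {T : Set (FreeGroup α)} (hT : IsNielsenReduced T)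
    (hinv : ∀ x ∈ T, x⁻¹ ∈ T) (hgen : Subgroup.closure T = ⊤) {g : FreeGroup α}
    (hg : norm g = 1) : g ∈ T := by
  obtain ⟨l, hl, hc, rfl⟩ := exists_isChain_prod_eq hinv hgen g
  match l with
  | [] => simp at hg
  | [s] => simpa using hl s
  | s :: t :: l =>
    have := (hT.norm_prod (t :: l) s hl hc).2 (by simp)
    omega

end FreeGroup
end

/-! ### Positive pairs and Nielsen reduction in rank two -/

noncomputable section

namespace FreeGroup

/-- The pairs obtained from a pair of letters of different type by simultaneous conjugation,
exchange of the two entries, and multiplication of one entry by the other. -/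
inductive PositivePair : FreeGroup (Fin 2) → FreeGroup (Fin 2) → Prop
  | base (a b : FreeGroup (Fin 2)) (ha : a = of 0 ∨ a = (of 0)⁻¹) (hb : b = of 1 ∨ b = (of 1)⁻¹) :
      PositivePair a b
  | swap (u v : FreeGroup (Fin 2)) : PositivePair u v → PositivePair v u
  | conj (g u v : FreeGroup (Fin 2)) :
      PositivePair u v → PositivePair (g⁻¹ * u * g) (g⁻¹ * v * g)
  | mul (u v : FreeGroup (Fin 2)) : PositivePair u v → PositivePair (u * v) v

/-- The pairs that are positive up to inverting the entries. -/
def SignedPositivePair (u v : FreeGroup (Fin 2)) : Prop :=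
  ∃ u' v', PositivePair u' v' ∧ (u = u' ∨ u = u'⁻¹) ∧ (v = v' ∨ v = v'⁻¹)

namespace SignedPositivePair

theorem of_positive {u v : FreeGroup (Fin 2)} (h : PositivePair u v) : SignedPositivePair u v :=
  ⟨u, v, h, Or.inl rfl, Or.inl rfl⟩

theorem swap {u v : FreeGroup (Fin 2)} : SignedPositivePair u v → SignedPositivePair v u := by
  rintro ⟨u', v', h, hu, hv⟩
  exact ⟨v', u', h.swap, hv, hu⟩

theorem inv_left {u v : FreeGroup (Fin 2)} :
    SignedPositivePair u v → SignedPositivePair u⁻¹ v := by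
  rintro ⟨u', v', h, rfl | rfl, hv⟩
  · exact ⟨_, v', h, Or.inr rfl, hv⟩
  · exact ⟨_, v', h, Or.inl (inv_inv _), hv⟩

theorem inv_right {u v : FreeGroup (Fin 2)} (h : SignedPositivePair u v) :
    SignedPositivePair u v⁻¹ := h.swap.inv_left.swap

theorem conj (g : FreeGroup (Fin 2)) {u v : FreeGroup (Fin 2)} :
    SignedPositivePair u v → SignedPositivePair (g⁻¹ * u * g) (g⁻¹ * v * g) := by
  rintro ⟨u', v', h, hu, hv⟩
  refine ⟨_, _, h.conj g, ?_, ?_⟩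
  · rcases hu with rfl | rfl
    · exact Or.inl rfl
    · exact Or.inr (by group)
  · rcases hv with rfl | rfl
    · exact Or.inl rfl
    · exact Or.inr (by group)

theorem of_conj (g : FreeGroup (Fin 2)) {u v : FreeGroup (Fin 2)}
    (h : SignedPositivePair (g⁻¹ * u * g) (g⁻¹ * v * g)) : SignedPositivePair u v := by
  have := h.conj g⁻¹
  convert this using 1 <;> group

/-- Division either undoes the last multiplication, up to conjugation, or passes to the starting
letters, where it is multiplication by the inverse letter. This is why the base case allows all four
sign choices. -/
theorem div_of_positive {u v : FreeGroup (Fin 2)} (h : PositivePair u v) :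
    SignedPositivePair (u * v⁻¹) v ∧ SignedPositivePair (v * u⁻¹) u := by
  induction h with
  | base a b ha hb =>
    have ha' : a⁻¹ = of 0 ∨ a⁻¹ = (of 0)⁻¹ := by
      rcases ha with rfl | rfl <;> simp
    have hb' : b⁻¹ = of 1 ∨ b⁻¹ = (of 1)⁻¹ := by
      rcases hb with rfl | rfl <;> simp
    constructor
    · have := (of_positive (PositivePair.base a b⁻¹ ha hb').mul).inv_right
      rwa [inv_inv] at this
    · have := (of_positive (PositivePair.base a⁻¹ b ha' hb).swap.mul).inv_right
      rwa [inv_inv] at this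
  | swap u v _ ih => exact ih.symm
  | conj g u v _ ih =>
    have h1 := ih.1.conj g
    have h2 := ih.2.conj g
    constructor
    · convert h1 using 1; group
    · convert h2 using 1; group
  | mul u v h _ =>
    constructor
    · rw [mul_inv_cancel_right]; exact of_positive h
    · have h1 := (of_positive h.swap.mul).conj u⁻¹
      have h2 : SignedPositivePair (u * v) u := by convert h1 using 1 <;> group
      have h3 := h2.swap.inv_left
      convert h3 using 1; group

theorem mul {u v : FreeGroup (Fin 2)} : SignedPositivePair u v → SignedPositivePair (u * v) v := by
  rintro ⟨u', v', h, rfl | rfl, rfl | rfl⟩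
  · exact of_positive h.mul
  · exact (div_of_positive h).1.inv_right
  · have h1 := ((div_of_positive h).1.inv_left).conj v
    convert h1 using 1 <;> group
  · have h1 := (of_positive h.mul).inv_left.inv_right.conj v'⁻¹
    convert h1 using 1 <;> group

/-- Signed positive pairs are closed under Nielsen moves; this form carries positivity back from a
shortened pair. -/
theorem of_mul {u v : FreeGroup (Fin 2)} (h : SignedPositivePair (u * v) v) :
    SignedPositivePair u v := by
  have := h.inv_right.mul.inv_right
  simpa using this

theorem of_mul_left {u v : FreeGroup (Fin 2)} (h : SignedPositivePair u (u * v)) :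
    SignedPositivePair u v := by
  have h1 := h.inv_right.inv_left.swap
  rw [mul_inv_rev] at h1
  simpa using h1.of_mul.inv_left.swap.inv_left

end SignedPositivePair

/-- The entries of a pair together with their inverses. -/
def symmPair (u v : FreeGroup (Fin 2)) : Set (FreeGroup (Fin 2)) := {u, u⁻¹, v, v⁻¹}

theorem inv_mem_symmPair {u v x : FreeGroup (Fin 2)} (hx : x ∈ symmPair u v) :
    x⁻¹ ∈ symmPair u v := by
  simp only [symmPair, Set.mem_insert_iff, Set.mem_singleton_iff] at hx ⊢
  rcases hx with rfl | rfl | rfl | rfl <;> simp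

theorem closure_pair_eq_top_of_mem {G : Type*} [Group G] {u v x y : G}
    (h : Subgroup.closure {u, v} = ⊤) (hu : u ∈ Subgroup.closure {x, y})
    (hv : v ∈ Subgroup.closure {x, y}) : Subgroup.closure {x, y} = ⊤ := by
  rw [eq_top_iff, ← h, Subgroup.closure_le]
  rintro _ (rfl | rfl)
  · exact hu
  · exact hv

theorem closure_conj_pair_eq_top {G : Type*} [Group G] {u v : G}
    (h : Subgroup.closure {u, v} = ⊤) (g : G) :
    Subgroup.closure {g⁻¹ * u * g, g⁻¹ * v * g} = ⊤ := by
  have h1 := (MonoidHom.map_closure (MulAut.conj g⁻¹).toMonoidHom {u, v}).symm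
  rw [h, Subgroup.map_top_of_surjective _ (MulAut.conj g⁻¹).surjective, Set.image_pair] at h1
  simpa using h1

/-- The two inequalities force one element to be `u` or its inverse and the other to be `v` or its
inverse, so `x, y` may replace `u, v`. -/
theorem symmPair_cases {u v x y : FreeGroup (Fin 2)} (hgen : Subgroup.closure {u, v} = ⊤)
    (hx : x ∈ symmPair u v) (hy : y ∈ symmPair u v) (hxy : x * y ≠ 1) (hne : x ≠ y) :
    (SignedPositivePair x y → SignedPositivePair u v) ∧ Subgroup.closure {x, y} = ⊤ ∧
      norm x + norm y = norm u + norm v := by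
  have key : ∀ x y : FreeGroup (Fin 2), (x = u ∨ x = u⁻¹) → (y = v ∨ y = v⁻¹) →
      (SignedPositivePair x y → SignedPositivePair u v) ∧ Subgroup.closure {x, y} = ⊤ ∧
        norm x + norm y = norm u + norm v := by
    intro x y ha hb
    have hxm : x ∈ Subgroup.closure {x, y} := Subgroup.subset_closure (by simp)
    have hym : y ∈ Subgroup.closure {x, y} := Subgroup.subset_closure (by simp)
    refine ⟨fun h => ?_, closure_pair_eq_top_of_mem hgen ?_ ?_, ?_⟩
    · have h1 : SignedPositivePair u y := by
        rcases ha with rfl | rfl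
        · exact h
        · simpa using h.inv_left
      rcases hb with rfl | rfl
      · exact h1
      · simpa using h1.inv_right
    · rcases ha with rfl | rfl
      · exact hxm
      · simpa using inv_mem hxm
    · rcases hb with rfl | rfl
      · exact hym
      · simpa using inv_mem hym
    · rcases ha with rfl | rfl <;> rcases hb with rfl | rfl <;> simp
  have key' : (y = u ∨ y = u⁻¹) → (x = v ∨ x = v⁻¹) →
      (SignedPositivePair x y → SignedPositivePair u v) ∧ Subgroup.closure {x, y} = ⊤ ∧
        norm x + norm y = norm u + norm v := by
    intro hy hx
    obtain ⟨h1, h2, h3⟩ := key y x hy hx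
    exact ⟨fun h => h1 h.swap, by rw [Set.pair_comm, h2], by rw [add_comm, h3]⟩
  have same : ∀ z, (x = z ∨ x = z⁻¹) → (y = z ∨ y = z⁻¹) → False := by
    rintro z (rfl | rfl) (rfl | rfl) <;> simp_all
  simp only [symmPair, Set.mem_insert_iff, Set.mem_singleton_iff, ← or_assoc] at hx hy
  rw [or_assoc] at hx hy
  rcases hx with hx | hx <;> rcases hy with hy | hy
  · exact (same _ hx hy).elim
  · exact key _ _ hx hy
  · exact key' hy hx
  · exact (same _ hx hy).elim

theorem eq_or_eq_inv_of_mem_symmPair {u v x y z : FreeGroup (Fin 2)}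
    (hx : x ∈ symmPair u v) (hy : y ∈ symmPair u v) (hz : z ∈ symmPair u v)
    (hxy : x * y ≠ 1) (hne : x ≠ y) (hyz : y * z ≠ 1) (hne' : y ≠ z) : z = x ∨ z = x⁻¹ := by
  have same : ∀ x y w : FreeGroup (Fin 2), x * y ≠ 1 → x ≠ y →
      (x = w ∨ x = w⁻¹) → (y = w ∨ y = w⁻¹) → False := by
    rintro x y w h1 h2 (rfl | rfl) (rfl | rfl) <;> simp_all
  have both : ∀ w : FreeGroup (Fin 2), (x = w ∨ x = w⁻¹) → (z = w ∨ z = w⁻¹) →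
      z = x ∨ z = x⁻¹ := by
    rintro w (rfl | rfl) (rfl | rfl) <;> simp
  simp only [symmPair, Set.mem_insert_iff, Set.mem_singleton_iff, ← or_assoc] at hx hy hz
  rw [or_assoc] at hx hy hz
  rcases hx with hx | hx <;> rcases hy with hy | hy <;> rcases hz with hz | hz <;>
    first
    | exact both _ hx hz
    | exact (same _ _ _ hxy hne hx hy).elim
    | exact (same _ _ _ hyz hne' hy hz).elim

theorem of_zero_mul_of_one_ne :
    (of 0 * of 1 : FreeGroup (Fin 2)) ≠ of 1 * of 0 := by decide

theorem ne_one_of_closure_pair {u v : FreeGroup (Fin 2)} (hgen : Subgroup.closure {u, v} = ⊤) :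
    u ≠ 1 := by
  rintro rfl
  have h1 : Subgroup.zpowers v = ⊤ := by
    rw [Subgroup.zpowers_eq_closure, eq_top_iff, ← hgen, Subgroup.closure_le]
    rintro _ (rfl | rfl)
    · exact one_mem _
    · exact Subgroup.subset_closure rfl
  obtain ⟨k, hk⟩ := Subgroup.mem_zpowers_iff.mp (h1 ▸ Subgroup.mem_top (of 0 : FreeGroup (Fin 2)))
  obtain ⟨l, hl⟩ := Subgroup.mem_zpowers_iff.mp (h1 ▸ Subgroup.mem_top (of 1 : FreeGroup (Fin 2)))
  exact of_zero_mul_of_one_ne (by rw [← hk, ← hl, ← zpow_add, ← zpow_add, add_comm])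

/-- A reduced generating set contains both letters, so the pair consists of letters up to order and
inversion. -/
theorem signedPositivePair_of_isNielsenReduced {u v : FreeGroup (Fin 2)}
    (hgen : Subgroup.closure {u, v} = ⊤) (hT : IsNielsenReduced (symmPair u v)) :
    SignedPositivePair u v := by
  have hgen' : Subgroup.closure (symmPair u v) = ⊤ := by
    rw [eq_top_iff, ← hgen]
    refine Subgroup.closure_mono ?_
    rintro _ (rfl | rfl) <;> simp [symmPair]
  have h0 : (of 0 : FreeGroup (Fin 2)) ∈ symmPair u v :=
    hT.mem_of_norm_eq_one (fun _ => inv_mem_symmPair) hgen' (norm_of 0)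
  have h1 : (of 1 : FreeGroup (Fin 2)) ∈ symmPair u v :=
    hT.mem_of_norm_eq_one (fun _ => inv_mem_symmPair) hgen' (norm_of 1)
  exact (symmPair_cases hgen h0 h1 (by decide) (by decide)).1
    (.of_positive (.base _ _ (Or.inl rfl) (Or.inl rfl)))

/-- Nielsen: every generating pair is positive up to inverting the entries. -/
theorem signedPositivePair_of_closure_eq_top : ∀ (n : ℕ) (u v : FreeGroup (Fin 2)),
    norm u + norm v = n → Subgroup.closure {u, v} = ⊤ → SignedPositivePair u v := by
  intro n
  induction n using Nat.strong_induction_on with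
  | _ n ih =>
  intro u v hn hgen
  by_contra hS
  have hne : ∀ x ∈ symmPair u v, x ≠ 1 := by
    have hu := ne_one_of_closure_pair hgen
    have hv : v ≠ 1 := ne_one_of_closure_pair (by rwa [Set.pair_comm] at hgen)
    intro x hx
    simp only [symmPair, Set.mem_insert_iff, Set.mem_singleton_iff] at hx
    rcases hx with rfl | rfl | rfl | rfl <;> simpa
  have hself : ∀ x ∈ symmPair u v, 2 * gromovProduct x⁻¹ x < norm x :=
    fun x hx => two_mul_gromovProduct_inv_self_lt (hne x hx)
  -- If more than half of a factor cancelled, replacing the other factor by `x * y` would shorten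
  -- the pair, and induction would apply.
  have hle : ∀ x ∈ symmPair u v, ∀ y ∈ symmPair u v, x * y ≠ 1 →
      2 * gromovProduct x⁻¹ y ≤ norm x ∧ 2 * gromovProduct x⁻¹ y ≤ norm y := by
    intro x hx y hy hxy
    by_cases hxy' : x = y
    · subst hxy'
      exact ⟨(hself x hx).le, (hself x hx).le⟩
    obtain ⟨h1, h2, h3⟩ := symmPair_cases hgen hx hy hxy hxy'
    have h4 := norm_mul x y
    have e1 : ∀ a b : FreeGroup (Fin 2), a ∈ Subgroup.closure {a, b} :=
      fun a b => Subgroup.subset_closure (by simp)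
    have e2 : ∀ a b : FreeGroup (Fin 2), b ∈ Subgroup.closure {a, b} :=
      fun a b => Subgroup.subset_closure (by simp)
    constructor
    · by_contra! h
      refine hS (h1 (ih (norm x + norm (x * y)) (by omega) x (x * y) rfl ?_).of_mul_left)
      refine closure_pair_eq_top_of_mem h2 (e1 _ _) ?_
      simpa using mul_mem (inv_mem (e1 x (x * y))) (e2 x (x * y))
    · by_contra! h
      refine hS (h1 (ih (norm (x * y) + norm y) (by omega) (x * y) y rfl ?_).of_mul)
      refine closure_pair_eq_top_of_mem h2 ?_ (e2 _ _)
      simpa using mul_mem (e1 (x * y) y) (inv_mem (e2 (x * y) y))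
  refine hS (signedPositivePair_of_isNielsenReduced hgen ⟨hne, hle, ?_⟩)
  intro x hx y hy z hz hxy hyz
  by_contra! hlt
  have b1 := (hle x hx y hy hxy).2
  have b2 := hle y hy z hz hyz
  have b3 := (hle x hx y hy hxy).1
  have bs := hself y hy
  -- Both cancellations are now exactly half of `y`, which rules out cancellation of `y` with
  -- itself. So `z` is `x` or `x⁻¹`. In the first case a simultaneous conjugation makes the pair `y,
  -- y * x` shorter than `x, y`, so no tie-breaking order on words is needed; in the second the
  -- ultrametric inequality makes `y` cancel half of itself.
  have hxy' : x ≠ y := by rintro rfl; omega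
  have hyz' : y ≠ z := by rintro rfl; omega
  obtain ⟨h1, h2, h3⟩ := symmPair_cases hgen hx hy hxy hxy'
  rcases eq_or_eq_inv_of_mem_symmPair hx hy hz hxy hxy' hyz hyz' with rfl | rfl
  · obtain ⟨m, hm⟩ : ∃ m, norm y = 2 * m := ⟨gromovProduct z⁻¹ y, by omega⟩
    have hm0 : norm y ≠ 0 := fun h => hne y hy (norm_eq_zero.mp h)
    obtain ⟨p, hp1, hp2⟩ := exists_conj_norm_le hm (by omega) (by omega : m ≤ gromovProduct y⁻¹ z)
      (by omega)
    refine hS (h1 (SignedPositivePair.of_mul_left (SignedPositivePair.of_conj p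
      (ih _ ?_ _ _ rfl (closure_conj_pair_eq_top ?_ p)))).swap)
    · omega
    · refine closure_pair_eq_top_of_mem h2 ?_ (Subgroup.subset_closure (by simp))
      have e1 : y ∈ Subgroup.closure {y, y * z} := Subgroup.subset_closure (by simp)
      have e2 : y * z ∈ Subgroup.closure {y, y * z} := Subgroup.subset_closure (by simp)
      simpa using mul_mem (inv_mem e1) e2
  · have c := min_gromovProduct_le y⁻¹ x⁻¹ y
    omega

/-! ### Exponent sums and conjugacy to the standard basis -/

/-- The exponent sum of the generator `i`. -/
def exponentSum (i : Fin 2) : FreeGroup (Fin 2) →* Multiplicative ℤ :=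
  FreeGroup.lift fun j => if j = i then Multiplicative.ofAdd 1 else 1

/-- The exponent sum of the generator `i`, as an integer. -/
def expSum (i : Fin 2) (w : FreeGroup (Fin 2)) : ℤ := (exponentSum i w).toAdd

theorem expSum_mul (i : Fin 2) (v w : FreeGroup (Fin 2)) :
    expSum i (v * w) = expSum i v + expSum i w := by simp [expSum]

theorem expSum_inv (i : Fin 2) (w : FreeGroup (Fin 2)) : expSum i w⁻¹ = -expSum i w := by
  simp [expSum]

theorem expSum_of (i j : Fin 2) : expSum i (of j) = if j = i then 1 else 0 := by
  simp [expSum, exponentSum, apply_ite Multiplicative.toAdd]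

theorem expSum_congr (i : Fin 2) {v w : FreeGroup (Fin 2)}
    (h : Abelianization.of v = Abelianization.of w) : expSum i v = expSum i w := by
  have := congrArg (Abelianization.lift (exponentSum i)) h
  simpa [expSum] using this

/-- The signs are those of the starting letters. Exchange and conjugation preserve the total weight,
while a multiplication brings it to at least 3, so total weight 2 leaves only conjugates of letters.
-/
theorem PositivePair.exists_weights {u v : FreeGroup (Fin 2)} (h : PositivePair u v) :
    ∃ ε δ : ℤ, (ε = 1 ∨ ε = -1) ∧ (δ = 1 ∨ δ = -1) ∧
      1 ≤ ε * expSum 0 u + δ * expSum 1 u ∧ 1 ≤ ε * expSum 0 v + δ * expSum 1 v ∧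
      ((ε * expSum 0 u + δ * expSum 1 u) + (ε * expSum 0 v + δ * expSum 1 v) = 2 →
        ∃ g : FreeGroup (Fin 2),
          (u = g⁻¹ * of 0 ^ ε * g ∧ v = g⁻¹ * of 1 ^ δ * g) ∨
          (u = g⁻¹ * of 1 ^ δ * g ∧ v = g⁻¹ * of 0 ^ ε * g)) := by
  induction h with
  | base a b ha hb =>
    rcases ha with rfl | rfl <;> rcases hb with rfl | rfl
    · refine ⟨1, 1, by simp, by simp, ?_, ?_, fun _ => ⟨1, Or.inl (by simp)⟩⟩ <;>
        simp [expSum_of]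
    · refine ⟨1, -1, by simp, by simp, ?_, ?_, fun _ => ⟨1, Or.inl (by simp)⟩⟩ <;>
        simp [expSum_of, expSum_inv]
    · refine ⟨-1, 1, by simp, by simp, ?_, ?_, fun _ => ⟨1, Or.inl (by simp)⟩⟩ <;>
        simp [expSum_of, expSum_inv]
    · refine ⟨-1, -1, by simp, by simp, ?_, ?_, fun _ => ⟨1, Or.inl (by simp)⟩⟩ <;>
        simp [expSum_of, expSum_inv]
  | swap u v _ ih =>
    obtain ⟨ε, δ, hε, hδ, hu, hv, h⟩ := ih
    refine ⟨ε, δ, hε, hδ, hv, hu, fun h2 => ?_⟩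
    obtain ⟨g, hg | hg⟩ := h (by linarith)
    · exact ⟨g, Or.inr hg.symm⟩
    · exact ⟨g, Or.inl hg.symm⟩
  | conj k u v _ ih =>
    obtain ⟨ε, δ, hε, hδ, hu, hv, h⟩ := ih
    have e : ∀ i w, expSum i (k⁻¹ * w * k) = expSum i w := by
      intro i w; rw [expSum_mul, expSum_mul, expSum_inv]; ring
    simp only [e]
    refine ⟨ε, δ, hε, hδ, hu, hv, fun h2 => ?_⟩
    obtain ⟨g, ⟨hg, hg'⟩ | ⟨hg, hg'⟩⟩ := h h2
    · exact ⟨g * k, Or.inl ⟨by rw [hg]; group, by rw [hg']; group⟩⟩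
    · exact ⟨g * k, Or.inr ⟨by rw [hg]; group, by rw [hg']; group⟩⟩
  | mul u v _ ih =>
    obtain ⟨ε, δ, hε, hδ, hu, hv, h⟩ := ih
    refine ⟨ε, δ, hε, hδ, ?_, hv, fun h2 => ?_⟩
    · rw [expSum_mul, expSum_mul]; linarith
    · rw [expSum_mul, expSum_mul] at h2; linarith

/-- A generating pair that agrees with the standard basis modulo commutators is conjugate to the
standard basis. -/
theorem exists_conj_eq_of {u v : FreeGroup (Fin 2)} (hgen : Subgroup.closure {u, v} = ⊤)
    (hu : Abelianization.of u = Abelianization.of (of 0))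
    (hv : Abelianization.of v = Abelianization.of (of 1)) :
    ∃ g : FreeGroup (Fin 2), u = g⁻¹ * of 0 * g ∧ v = g⁻¹ * of 1 * g := by
  have u0 := expSum_congr 0 hu
  have u1 := expSum_congr 1 hu
  have v0 := expSum_congr 0 hv
  have v1 := expSum_congr 1 hv
  simp only [expSum_of, if_true, Fin.isValue, zero_ne_one, one_ne_zero, if_false] at u0 u1 v0 v1
  obtain ⟨u', v', h, hu', hv'⟩ := signedPositivePair_of_closure_eq_top _ u v rfl hgen
  have hu'' : u' = u ∨ u' = u⁻¹ := by rcases hu' with rfl | rfl <;> simp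
  have hv'' : v' = v ∨ v' = v⁻¹ := by rcases hv' with rfl | rfl <;> simp
  clear hu' hv'
  obtain ⟨ε, δ, hε, hδ, h1, h2, h3⟩ := h.exists_weights
  have ec : ∀ (g w : FreeGroup (Fin 2)) (i : Fin 2), expSum i (g⁻¹ * w * g) = expSum i w := by
    intro g w i; rw [expSum_mul, expSum_mul, expSum_inv]; ring
  -- The weight of a signed standard generator is 1 or -1, and it is positive.
  have fu : ε * expSum 0 u' + δ * expSum 1 u' = 1 := by
    rcases hu'' with rfl | rfl <;> rcases hε with rfl | rfl <;>
      simp [expSum_inv, u0, u1] at h1 ⊢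
  have fv : ε * expSum 0 v' + δ * expSum 1 v' = 1 := by
    rcases hv'' with rfl | rfl <;> rcases hδ with rfl | rfl <;>
      simp [expSum_inv, v0, v1] at h2 ⊢
  obtain ⟨g, ⟨hg, hg'⟩ | ⟨hg, hg'⟩⟩ := h3 (by omega)
  · refine ⟨g, ?_, ?_⟩
    · have hw : u' = u ∧ ε = 1 ∨ u' = u⁻¹ ∧ ε = -1 := by
        rcases hu'' with rfl | rfl <;> rcases hε with rfl | rfl <;>
          simp [expSum_inv, u0, u1] at fu ⊢
      rcases hw with ⟨rfl, rfl⟩ | ⟨e, rfl⟩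
      · simpa using hg
      · rw [← inv_inv u, ← e, hg]; group
    · have hw : v' = v ∧ δ = 1 ∨ v' = v⁻¹ ∧ δ = -1 := by
        rcases hv'' with rfl | rfl <;> rcases hδ with rfl | rfl <;>
          simp [expSum_inv, v0, v1] at fv ⊢
      rcases hw with ⟨rfl, rfl⟩ | ⟨e, rfl⟩
      · simpa using hg'
      · rw [← inv_inv v, ← e, hg']; group
  -- In the exchanged case `u'` would be conjugate to a power of the second generator, although its
  -- exponent sum in the first is nonzero.
  · exfalso
    have h4 : expSum 0 u' = 0 := by
      rw [hg, ec]
      rcases hδ with rfl | rfl <;> simp [expSum_of, expSum_inv]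
    rcases hu'' with rfl | rfl
    · omega
    · rw [expSum_inv] at h4; omega

end FreeGroup
end

/-! ### Inner automorphisms and the Magnus kernel -/

noncomputable section

section Inner

variable {n : ℕ} {Q : Type*} [Group Q] (π : FreeGroup (Fin n) →* Q)

/-- Expand the derivative of `x * g = g * (g⁻¹ * x * g)` in two ways. -/
theorem foxAlong_inv_mul_mul (j : Fin n) (g x : FreeGroup (Fin n)) :
    MonoidAlgebra.of ℤ Q (π g) * foxAlong π j (g⁻¹ * x * g) =
      foxAlong π j x + MonoidAlgebra.of ℤ Q (π x) * foxAlong π j g - foxAlong π j g := by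
  have h := foxAlong_mul π j g (g⁻¹ * x * g)
  rw [show g * (g⁻¹ * x * g) = x * g by group, foxAlong_mul] at h
  rw [h]
  abel

/-- On the kernel the derivative is a homomorphism to an abelian group, hence kills commutators. -/
theorem foxAlong_eq_zero_of_mem_commutator {g : FreeGroup (Fin n)} (hg : g ∈ ⁅π.ker, π.ker⁆)
    (j : Fin n) : foxAlong π j g = 0 := by
  let L : Subgroup (FreeGroup (Fin n)) :=
    { carrier := {w | w ∈ π.ker ∧ foxAlong π j w = 0}
      one_mem' := ⟨one_mem _, foxAlong_one π j⟩
      mul_mem' := fun {a b} ha hb => ⟨mul_mem ha.1 hb.1, by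
        rw [foxAlong_mul, ha.2, hb.2, mul_zero, add_zero]⟩
      inv_mem' := fun {a} ha => ⟨inv_mem ha.1, by rw [foxAlong_inv, ha.2, mul_zero, neg_zero]⟩ }
  have hL : ⁅π.ker, π.ker⁆ ≤ L := by
    rw [Subgroup.commutator_le]
    intro a ha b hb
    refine ⟨Subgroup.commutator_le_right _ _ (Subgroup.commutator_mem_commutator ha hb), ?_⟩
    rw [MonoidHom.mem_ker] at ha hb
    simp only [commutatorElement_def, foxAlong_mul, foxAlong_inv, map_mul, map_inv, ha, hb,
      inv_one, map_one, one_mul]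
    abel
  exact (hL hg).2

/-- If conjugation by `g` does not change the Fox derivatives of the generators, then `g` and its
Fox derivatives are trivial. -/
theorem eq_one_and_foxAlong_eq_zero (hn : Nontrivial (Fin n))
    (hπ : ∀ i, ¬ IsOfFinOrder (π (FreeGroup.of i))) {g : FreeGroup (Fin n)}
    (h : ∀ i j, foxAlong π j (g⁻¹ * FreeGroup.of i * g) = if i = j then 1 else 0) :
    π g = 1 ∧ ∀ j, foxAlong π j g = 0 := by
  have h0 : ∀ j, foxAlong π j g = 0 := by
    intro j
    -- A generator other than `x_j` gives `(x_i - 1) ∂_j g = 0`; this is where rank at least two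
    -- enters.
    obtain ⟨i, hi⟩ := exists_ne j
    refine eq_zero_of_translate_eq (hπ i) ?_
    have h1 := foxAlong_inv_mul_mul π j g (FreeGroup.of i)
    rw [h, if_neg hi, mul_zero, foxAlong_gen, if_neg hi, zero_add] at h1
    exact (sub_eq_zero.mp h1.symm)
  refine ⟨?_, h0⟩
  obtain ⟨i, _⟩ := hn.exists_pair_ne
  have h1 := foxAlong_inv_mul_mul π i g (FreeGroup.of i)
  rw [h, if_pos rfl, h0, foxAlong_gen, if_pos rfl, mul_zero, add_zero, sub_zero, mul_one,
    ← map_one (MonoidAlgebra.of ℤ Q)] at h1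
  exact MonoidAlgebra.of_injective h1

end Inner

theorem not_isOfFinOrder_of_expSum {Q : Type*} [Group Q] (π : FreeGroup (Fin 2) →* Q)
    (f : Q →* Multiplicative ℤ) (i : Fin 2) (hf : f (π (FreeGroup.of i)) ≠ 1) :
    ¬ IsOfFinOrder (π (FreeGroup.of i)) := fun h =>
  hf (f.isOfFinOrder h).eq_one'

theorem exponentSum_of_ne_one (i : Fin 2) : FreeGroup.exponentSum i (FreeGroup.of i) ≠ 1 := by
  intro h
  have := FreeGroup.expSum_of i i
  rw [FreeGroup.expSum, h, if_pos rfl] at this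
  exact absurd this (by simp)

theorem mem_IAut_iff {n : ℕ} (σ : RightAut (FreeGroup (Fin n))) :
    σ ∈ IAut n ↔ ∀ w, Abelianization.of (σ.act w) = Abelianization.of w := by
  refine ⟨fun h w => IAut.ab_act h w, fun h => ?_⟩
  refine MonoidHom.mem_ker.mpr (MulOpposite.unop_injective (MulEquiv.ext fun x => ?_))
  obtain ⟨w, rfl⟩ := QuotientGroup.mk_surjective x
  exact h w

/-- The inner automorphism `x ↦ g⁻¹ x g`, as a homomorphism in `g`. -/
def innerIA (n : ℕ) : FreeGroup (Fin n) →* IAut n where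
  toFun g := ⟨MulOpposite.op (MulAut.conj g⁻¹), by
    rw [mem_IAut_iff]
    intro w
    change Abelianization.of (g⁻¹ * w * g⁻¹⁻¹) = _
    rw [inv_inv, map_mul, map_mul, map_inv, mul_comm, mul_inv_cancel_left]⟩
  map_one' := by
    apply Subtype.ext
    simp
  map_mul' g h := by
    apply Subtype.ext
    simp

theorem innerIA_act {n : ℕ} (g x : FreeGroup (Fin n)) :
    RightAut.act (innerIA n g : RightAut (FreeGroup (Fin n))) x = g⁻¹ * x * g := by
  change g⁻¹ * x * g⁻¹⁻¹ = _
  rw [inv_inv]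

/-- The Fox argument with `π` the identity, where `π g = 1` reads `g = 1`. -/
theorem innerIA_injective : Function.Injective (innerIA 2) := by
  rw [injective_iff_map_eq_one]
  intro g hg
  refine (eq_one_and_foxAlong_eq_zero (MonoidHom.id (FreeGroup (Fin 2))) inferInstance
    (fun i => not_isOfFinOrder_of_expSum _ (FreeGroup.exponentSum i) i (exponentSum_of_ne_one i))
    (fun i j => ?_)).1
  rw [← innerIA_act, hg]
  exact foxAlong_gen _ j i

/-- Nielsen: every automorphism in `IA_2` is inner. -/
theorem innerIA_surjective : Function.Surjective (innerIA 2) := by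
  intro σ
  have hgen : Subgroup.closure {σ.1.act (FreeGroup.of 0), σ.1.act (FreeGroup.of 1)} = ⊤ := by
    have h1 := (MonoidHom.map_closure σ.1.unop.toMonoidHom
      (Set.range (FreeGroup.of : Fin 2 → FreeGroup (Fin 2)))).symm
    rw [FreeGroup.closure_range_of, Subgroup.map_top_of_surjective _ σ.1.unop.surjective] at h1
    rw [← h1]
    congr 1
    ext x
    simp [RightAut.act, eq_comm]
  obtain ⟨g, h0, h1⟩ := FreeGroup.exists_conj_eq_of hgen (IAut.ab_act σ.2 _) (IAut.ab_act σ.2 _)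
  refine ⟨g, Subtype.ext (MulOpposite.unop_injective (MulEquiv.toMonoidHom_injective ?_))⟩
  refine FreeGroup.ext_hom _ _ fun i => ?_
  change RightAut.act (innerIA 2 g : RightAut (FreeGroup (Fin 2))) (FreeGroup.of i) =
    σ.1.act (FreeGroup.of i)
  rw [innerIA_act]
  fin_cases i
  · exact h0.symm
  · exact h1.symm

/-- The Fox argument with `π` the abelianization, whose kernel is the derived subgroup, followed by
Magnus's theorem; the converse uses the vanishing of the derivatives on commutators of the kernel.
-/
theorem innerIA_mem_magnusKernel_iff (g : FreeGroup (Fin 2)) :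
    innerIA 2 g ∈ magnusKernel 2 ↔ g ∈ secondDerived (FreeGroup (Fin 2)) := by
  have hker : (Abelianization.of : FreeGroup (Fin 2) →* FreeAb 2).ker =
      commutator (FreeGroup (Fin 2)) := Abelianization.ker_of _
  have hmat : innerIA 2 g ∈ magnusKernel 2 ↔
      ∀ i j, foxAlong (Abelianization.of : FreeGroup (Fin 2) →* FreeAb 2) j
        (g⁻¹ * FreeGroup.of i * g) = if i = j then 1 else 0 := by
    rw [magnusKernel, MonoidHom.mem_ker, Units.ext_iff, magnusRep_val, ← Matrix.ext_iff]
    refine forall_congr' fun i => forall_congr' fun j => ?_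
    rw [← innerIA_act, Units.val_one, Matrix.one_apply]
    rfl
  rw [hmat, secondDerived, ← hker]
  constructor
  · intro h
    obtain ⟨h1, h2⟩ := eq_one_and_foxAlong_eq_zero Abelianization.of inferInstance
      (fun i => not_isOfFinOrder_of_expSum _ (Abelianization.lift (FreeGroup.exponentSum i)) i
        (by rw [Abelianization.lift_apply_of]; exact exponentSum_of_ne_one i)) h
    exact mem_commutator_of_foxAlong_eq_zero _ (QuotientGroup.mk_surjective) h1 h2
  · intro hg i j
    have h1 := foxAlong_inv_mul_mul Abelianization.of j g (FreeGroup.of i)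
    have h2 : Abelianization.of g = 1 := Subgroup.commutator_le_right _ _ hg
    rw [foxAlong_eq_zero_of_mem_commutator _ hg, h2, map_one, one_mul, mul_zero, add_zero,
      sub_zero, foxAlong_gen] at h1
    exact h1

/-- The isomorphism from the second derived subgroup onto the kernel of the Magnus
representation. -/
def secondDerivedEquivMagnusKernel : secondDerived (FreeGroup (Fin 2)) ≃* magnusKernel 2 :=
  MulEquiv.ofBijective
    (((innerIA 2).comp (secondDerived (FreeGroup (Fin 2))).subtype).codRestrict (magnusKernel 2)
      fun g => (innerIA_mem_magnusKernel_iff g).mpr g.2)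
    ⟨fun g h hgh => Subtype.ext (innerIA_injective (congrArg Subtype.val hgh)), fun σ => by
      obtain ⟨g, hg⟩ := innerIA_surjective σ.1
      exact ⟨⟨g, (innerIA_mem_magnusKernel_iff g).mp (hg ▸ σ.2)⟩, Subtype.ext hg⟩⟩

/-! ### Infinite rank of the second derived subgroup -/

instance secondDerived_normal (G : Type*) [Group G] : (secondDerived G).Normal :=
  Subgroup.commutator_normal _ _

open scoped commutatorElement in
theorem secondDerived_ne_bot : secondDerived (FreeGroup (Fin 2)) ≠ ⊥ := by
  intro h
  have hmem : ∀ a b : FreeGroup (Fin 2), ⁅a, b⁆ ∈ commutator (FreeGroup (Fin 2)) := fun a b =>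
    Subgroup.commutator_mem_commutator (Subgroup.mem_top a) (Subgroup.mem_top b)
  let x : FreeGroup (Fin 2) := FreeGroup.of 0
  let y : FreeGroup (Fin 2) := FreeGroup.of 1
  -- These two commutators do not commute; comparing reduced words decides it.
  have h1 : ⁅⁅x, y⁆, ⁅x, y⁻¹⁆⁆ ∈ secondDerived (FreeGroup (Fin 2)) :=
    Subgroup.commutator_mem_commutator (hmem _ _) (hmem _ _)
  rw [h, Subgroup.mem_bot] at h1
  revert h1
  simp only [commutatorElement_def]
  decide

theorem not_fg_secondDerived : ¬ Group.FG (secondDerived (FreeGroup (Fin 2))) := by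
  have hker : (QuotientGroup.mk' (secondDerived (FreeGroup (Fin 2)))).ker =
      secondDerived (FreeGroup (Fin 2)) := QuotientGroup.ker_mk' _
  have hle : secondDerived (FreeGroup (Fin 2)) ≤ (FreeGroup.exponentSum 0).ker :=
    (Subgroup.commutator_le_right _ _).trans (Abelianization.commutator_subset_ker _)
  -- The exponent sum of the first generator maps this quotient onto ℤ.
  have hinf : Infinite (FreeGroup (Fin 2) ⧸ secondDerived (FreeGroup (Fin 2))) := by
    refine Infinite.of_surjective
      (QuotientGroup.lift (secondDerived (FreeGroup (Fin 2))) (FreeGroup.exponentSum 0) hle)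
      fun k => ⟨QuotientGroup.mk (FreeGroup.of 0 ^ k.toAdd), ?_⟩
    rw [QuotientGroup.lift_mk, map_zpow]
    simp [FreeGroup.exponentSum, ← ofAdd_zsmul]
  have h := not_finitelyGenerated_ker (QuotientGroup.mk' (secondDerived (FreeGroup (Fin 2))))
    (QuotientGroup.mk'_surjective _) (by rw [hker]; exact secondDerived_ne_bot)
  rwa [hker] at h

/-- A countable free group that is not finitely generated is free of countably infinite rank. -/
theorem IsFreeGroup.nonempty_basis_nat {G : Type*} [Group G] [IsFreeGroup G] [Countable G]
    (hG : ¬ Group.FG G) : Nonempty (FreeGroupBasis ℕ G) := by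
  have hc : Countable (IsFreeGroup.Generators G) := (IsFreeGroup.basis G).injective.countable
  have hi : Infinite (IsFreeGroup.Generators G) := by
    by_contra h
    rw [not_infinite_iff_finite] at h
    exact hG (Group.fg_of_surjective (f := (IsFreeGroup.mulEquiv G).toMonoidHom)
      (IsFreeGroup.mulEquiv G).surjective)
  obtain ⟨e⟩ := nonempty_equiv_of_countable (α := IsFreeGroup.Generators G) (β := ℕ)
  exact ⟨(IsFreeGroup.basis G).reindex e⟩

end

theorem proposition5p3 :
    (∃ e : secondDerived (FreeGroup (Fin 2)) ≃* magnusKernel 2,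
      ∀ (g : secondDerived (FreeGroup (Fin 2))) (x : FreeGroup (Fin 2)),
        RightAut.act (((e g : magnusKernel 2) : IAut 2) : RightAut (FreeGroup (Fin 2))) x =
          (g : FreeGroup (Fin 2))⁻¹ * x * (g : FreeGroup (Fin 2))) ∧
    Nonempty (FreeGroupBasis ℕ (magnusKernel 2)) := by
  refine ⟨⟨secondDerivedEquivMagnusKernel, fun g x => innerIA_act g.1 x⟩, ?_⟩
  have : Countable (FreeGroup (Fin 2)) := FreeGroup.toWord_injective.countable
  obtain ⟨b⟩ := IsFreeGroup.nonempty_basis_nat not_fg_secondDerived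
  exact ⟨b.map secondDerivedEquivMagnusKernel⟩
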